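/- Let $\mathbb T=\mathbb R/\mathbb Z$ with its usual topology $\tau$ and the metric $d(x,y)=\|x-y\|$, where $\|z\|$ is the distance from (a representative of) $z$ to the nearest integer. Let $\mathbf u=(u_n)_{n\ge 0}$ be an a-sequence, i.e. a strictly increasing sequence of integers with $u_n\mid u_{n+1}$ for all $n$. Put $q_0=u_0$, $q_n=u_n/u_{n-1}$ for $n\ge 1$, and $$t_{\mathbf u}(\mathbb T)=\{x\in\mathbb T: u_nx\to 0 \text{ in }\mathbb T\}.$$ Let $\delta$ be any metric on $\mathbb T$ inducing $\tau$ (for instance $\delta=d$), and let $\varrho_{\mathbf u}(x,y)=\sup_{n\ge0}\{\delta(x,y),\,d(u_nx,u_ny)\}$. Let $\tau_{\mathbf u}$ be the topology on $\mathbb T$ induced by the metric $\varrho_{\mathbf u}$, and let $\tau_{\mathbf u}^*$ be the group topology on $\mathbb T$ whose filter of neighbourhoods of $0$ is generated by the sets $W_n=\overline{\{x\in\mathbb T:\varrho_{\mathbf u}(x,0)<1/n\}}$, $n\ge1$, the closure being taken in $\tau$. Then the following are equivalent: (a) the sequence $(q_n)$ is bounded; (b) $t_{\mathbf u}(\mathbb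 T)\le\mathbb Q/\mathbb Z$; (c) $t_{\mathbf u}(\mathbb T)$ is countable; (d) $t_{\mathbf u}(\mathbb T)$ is an $F_\sigma$-set in $(\mathbb T,\tau)$; (e) $t_{\mathbf u}(\mathbb T)$ is $\tau_{\mathbf u}^*$-open; (f) $t_{\mathbf u}(\mathbb T)$ is $\tau_{\mathbf u}$-open. -/

import Mathlib

namespace CharSub

/-- The subgroup `t_u(X) = {x ∈ X : u_n x → 0 in X}`, for a sequence `u` of integers. -/
def tSubgroup (X : Type*) [AddCommGroup X] [TopologicalSpace X] [IsTopologicalAddGroup X]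
    (u : ℕ → ℤ) : AddSubgroup X where
  carrier := {x | Filter.Tendsto (fun n => u n • x) Filter.atTop (nhds 0)}
  zero_mem' := by
    simpa only [Set.mem_ofPred_eq, smul_zero] using tendsto_const_nhds
  add_mem' := by
    intro a b ha hb
    have h := Filter.Tendsto.add ha hb
    simpa only [Set.mem_ofPred_eq, smul_add, add_zero] using h
  neg_mem' := by
    intro a ha
    have h := Filter.Tendsto.neg ha
    simpa only [Set.mem_ofPred_eq, smul_neg, neg_zero] using h

/-- The sequence of characters `x ↦ u_n x` of the circle `𝕋 = ℝ/ℤ` given by integers `u_n`. -/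
def intChar (u : ℕ → ℤ) (n : ℕ) : UnitAddCircle →ₜ+ UnitAddCircle where
  toFun x := u n • x
  map_zero' := smul_zero _
  map_add' := smul_add _
  continuous_toFun := continuous_zsmul (u n)

/-- An a-sequence: a strictly increasing sequence of integers with `u_n ∣ u_{n+1}`. -/
def IsASequence (u : ℕ → ℤ) : Prop :=
  StrictMono u ∧ ∀ n, u n ∣ u (n + 1)

/-- The ratios: `q_0 = u_0` and `q_n = u_n / u_{n-1}` for `n > 0`. -/
def ratio (u : ℕ → ℤ) : ℕ → ℚ
  | 0 => (u 0 : ℚ)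
  | n + 1 => (u (n + 1) : ℚ) / (u n : ℚ)

/-- The subgroup `ℚ/ℤ` of `ℝ/ℤ`: the image of `ℚ ⊆ ℝ` under the projection. -/
noncomputable def ratCircle : AddSubgroup UnitAddCircle :=
  (Rat.castHom ℝ).toAddMonoidHom.range.map (QuotientAddGroup.mk' (AddSubgroup.zmultiples (1 : ℝ)))

/-- `F_σ`-sets: countable unions of closed sets. -/
def IsFSigma {X : Type*} [TopologicalSpace X] (s : Set X) : Prop :=
  ∃ F : ℕ → Set X, (∀ n, IsClosed (F n)) ∧ s = ⋃ n, F n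

/-- `δ` is a metric on `X` that induces the given topology of `X`. -/
def IsCompatibleMetric {X : Type*} [t : TopologicalSpace X] (δ : X → X → ℝ) : Prop :=
  ∃ m : MetricSpace X, m.toUniformSpace.toTopologicalSpace = t ∧ ∀ x y, m.dist x y = δ x y

/-- `ϱ_v(x, y) = sup {δ(x, y), d(v_n(x), v_n(y)) : n ∈ ℕ}`. The metric `d` of the circle is
the one of its quotient norm, and is at most `1/2`, so the supremum is over a bounded set. -/
noncomputable def rho {X : Type*} [AddCommGroup X] [TopologicalSpace X]
    (δ : X → X → ℝ) (v : ℕ → X →ₜ+ UnitAddCircle) (x y : X) : ℝ :=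
  sSup (insert (δ x y) (Set.range fun n => dist (v n x) (v n y)))

/-- The open ball of a distance function. -/
def ballOf {X : Type*} (ρ : X → X → ℝ) (x : X) (ε : ℝ) : Set X := {y | ρ y x < ε}

theorem ballOf_mono {X : Type*} (ρ : X → X → ℝ) (x : X) {ε ε' : ℝ} (h : ε ≤ ε') :
    ballOf ρ x ε ⊆ ballOf ρ x ε' := fun _ hy => lt_of_lt_of_le hy h

/-- The topology induced by a distance function: a set is open when it contains a ball around
each of its points. -/
@[reducible]
def metricTopology {X : Type*} (ρ : X → X → ℝ) : TopologicalSpace X where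
  IsOpen U := ∀ x ∈ U, ∃ ε > 0, ballOf ρ x ε ⊆ U
  isOpen_univ := fun _ _ => ⟨1, one_pos, Set.subset_univ _⟩
  isOpen_inter := by
    rintro U V hU hV x ⟨hxU, hxV⟩
    obtain ⟨ε, hε, h⟩ := hU x hxU
    obtain ⟨ε', hε', h'⟩ := hV x hxV
    exact ⟨min ε ε', lt_min hε hε', Set.subset_inter
      ((ballOf_mono ρ x (min_le_left _ _)).trans h)
      ((ballOf_mono ρ x (min_le_right _ _)).trans h')⟩
  isOpen_sUnion := by
    rintro S hS x ⟨U, hU, hxU⟩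
    obtain ⟨ε, hε, h⟩ := hS U hU x hxU
    exact ⟨ε, hε, h.trans (Set.subset_sUnion_of_mem hU)⟩

/-- The topology `τ_v` on `X` induced by `ϱ_v`. -/
@[reducible]
noncomputable def tau {X : Type*} [AddCommGroup X] [TopologicalSpace X]
    (δ : X → X → ℝ) (v : ℕ → X →ₜ+ UnitAddCircle) : TopologicalSpace X :=
  metricTopology (rho δ v)

/-- `W_n`: the closure, in the original topology of `X`, of the `ϱ_v`-ball of radius `1/n`
around `0`. It is used for `n ≥ 1`. -/
noncomputable def testNhd {X : Type*} [AddCommGroup X] [TopologicalSpace X]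
    (δ : X → X → ℝ) (v : ℕ → X →ₜ+ UnitAddCircle) (n : ℕ) : Set X :=
  closure (ballOf (rho δ v) 0 (1 / (n : ℝ)))

theorem testNhd_anti {X : Type*} [AddCommGroup X] [TopologicalSpace X]
    (δ : X → X → ℝ) (v : ℕ → X →ₜ+ UnitAddCircle) {m n : ℕ} (hm : 1 ≤ m) (h : m ≤ n) :
    testNhd δ v n ⊆ testNhd δ v m := by
  have hm' : (0 : ℝ) < m := by exact_mod_cast hm
  have h' : (m : ℝ) ≤ n := by exact_mod_cast h
  exact closure_mono (ballOf_mono _ _ (one_div_le_one_div_of_le hm' h'))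

/-- The `F_σ`-test topology `τ_v^*`: the group topology on `X` whose neighbourhoods of `0` are
generated by the sets `W_n`, `n ≥ 1`. A set `U` is open when for every `x ∈ U` it contains
some `x + W_n`. -/
@[reducible]
noncomputable def tauStar {X : Type*} [AddCommGroup X] [TopologicalSpace X]
    (δ : X → X → ℝ) (v : ℕ → X →ₜ+ UnitAddCircle) : TopologicalSpace X where
  IsOpen U := ∀ x ∈ U, ∃ n : ℕ, 1 ≤ n ∧ ∀ w ∈ testNhd δ v n, x + w ∈ U
  isOpen_univ := fun _ _ => ⟨1, le_rfl, fun _ _ => Set.mem_univ _⟩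
  isOpen_inter := by
    rintro U V hU hV x ⟨hxU, hxV⟩
    obtain ⟨m, hm, h⟩ := hU x hxU
    obtain ⟨n, hn, h'⟩ := hV x hxV
    exact ⟨max m n, hm.trans (le_max_left _ _), fun w hw =>
      ⟨h w (testNhd_anti δ v hm (le_max_left _ _) hw),
       h' w (testNhd_anti δ v hn (le_max_right _ _) hw)⟩⟩
  isOpen_sUnion := by
    rintro S hS x ⟨U, hU, hxU⟩
    obtain ⟨n, hn, h⟩ := hS U hU x hxU
    exact ⟨n, hn, fun w hw => ⟨U, hU, h w hw⟩⟩

end CharSub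

namespace CharSub

open Filter Topology

/-! ### The norm of the circle -/

/-! Suppose the ratios are bounded by `C` and `‖u n • x‖ ≤ r` for all `n ≥ N`, with `C * r ≤ 1 / 2`.
Multiplying `u n • x` by the next ratio does not wrap around the circle, so from index `N + 1` on
each step at least doubles the norm; hence `u (N + 1) • x = 0` (`zsmul_eq_zero_of_norm_le`). So
`t_u` is torsion, which gives (b), (c), (d), and it contains every `x` whose multiples are uniformly
small, which gives (e), (f). If the ratios are unbounded, let `y = ∑ ⌊ε u_{n+2} / u_{n+1}⌋ /
u_{n+2}`. The partial sums are torsion points of `t_u` on which all `u_n` are at most `2ε`, but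
`‖u_{n+1} y‖ ≥ ε / 2` whenever the ratio is at least `1 / ε` (`exists_tendsto_notMem_tSubgroup`).
The point `y` lies in any prescribed ball of `ϱ_u`, refuting (e) and (f). Against (d), Baire's
theorem puts a translate of all the partial sums, hence of `y`, into a closed subset of `t_u`. -/

theorem norm_coe_circle_le (r : ℝ) : ‖(r : UnitAddCircle)‖ ≤ |r| :=
  QuotientAddGroup.norm_mk_le_norm

theorem norm_coe_circle_of_le {r : ℝ} (h : |r| ≤ 1 / 2) : ‖(r : UnitAddCircle)‖ = |r| :=
  (AddCircle.norm_coe_eq_abs_iff 1 one_ne_zero).2 (by simpa using h)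

theorem norm_circle_le_half (x : UnitAddCircle) : ‖x‖ ≤ 1 / 2 := by
  simpa using AddCircle.norm_le_half_period 1 (x := x) one_ne_zero

theorem coe_intCast_circle (m : ℤ) : ((m : ℝ) : UnitAddCircle) = 0 :=
  (AddCircle.coe_eq_zero_iff 1).2 ⟨m, by simp⟩

theorem zsmul_coe_circle (m : ℤ) (r : ℝ) :
    m • (r : UnitAddCircle) = ((m * r : ℝ) : UnitAddCircle) := by
  rw [← zsmul_eq_mul]; rfl

theorem exists_coe_circle_abs_eq_norm (x : UnitAddCircle) :
    ∃ r : ℝ, (r : UnitAddCircle) = x ∧ |r| = ‖x‖ := by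
  induction x using QuotientAddGroup.induction_on with
  | H r =>
    refine ⟨r - round r, ?_, UnitAddCircle.norm_eq.symm⟩
    have h := coe_intCast_circle (round r)
    change ((r - round r : ℝ) : UnitAddCircle) = (r : UnitAddCircle)
    rw [AddCircle.coe_sub, h, sub_zero]

theorem norm_zsmul_circle {x : UnitAddCircle} {q : ℤ} (h : |(q : ℝ)| * ‖x‖ ≤ 1 / 2) :
    ‖q • x‖ = |(q : ℝ)| * ‖x‖ := by
  obtain ⟨r, rfl, hr⟩ := exists_coe_circle_abs_eq_norm x
  rw [← hr] at h ⊢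
  rw [zsmul_coe_circle, norm_coe_circle_of_le (by rwa [abs_mul]), abs_mul]

theorem mem_ratCircle_of_zsmul_eq_zero {x : UnitAddCircle} {m : ℤ} (hm : m ≠ 0)
    (h : m • x = 0) : x ∈ ratCircle := by
  induction x using QuotientAddGroup.induction_on with
  | H r =>
    change m • (r : UnitAddCircle) = 0 at h
    rw [zsmul_coe_circle, AddCircle.coe_eq_zero_iff] at h
    obtain ⟨k, hk⟩ := h
    refine ⟨r, ⟨(k : ℚ) / m, ?_⟩, rfl⟩
    have hm' : (m : ℝ) ≠ 0 := by exact_mod_cast hm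
    have hk' : (k : ℝ) = m * r := by simpa using hk
    simp [hk', hm']

theorem countable_ratCircle : (ratCircle : Set UnitAddCircle).Countable := by
  have h : (Set.range fun q : ℚ => ((q : ℝ) : UnitAddCircle)).Countable :=
    Set.countable_range _
  refine h.mono ?_
  rintro _ ⟨_, ⟨q, rfl⟩, rfl⟩
  exact ⟨q, rfl⟩

/-! ### `F_σ`-sets -/

theorem isFSigma_of_countable {X : Type*} [TopologicalSpace X] [T1Space X] {s : Set X}
    (hs : s.Countable) : IsFSigma s := by
  rcases s.eq_empty_or_nonempty with rfl | hne
  · exact ⟨fun _ => ∅, fun _ => isClosed_empty, by simp⟩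
  · obtain ⟨f, rfl⟩ := hs.exists_eq_range hne
    exact ⟨fun n => {f n}, fun n => isClosed_singleton, by ext; simp [eq_comm]⟩

theorem mem_tSubgroup {X : Type*} [AddCommGroup X] [TopologicalSpace X]
    [IsTopologicalAddGroup X] {u : ℕ → ℤ} {x : X} :
    x ∈ tSubgroup X u ↔ Tendsto (fun n => u n • x) atTop (𝓝 0) := Iff.rfl

/-- If `t_u` is a countable union of closed sets, then by Baire's theorem one of them contains a
translate of a small ball of `t_u` in its finer complete metric. -/
theorem exists_closed_of_isFSigma_tSubgroup {u : ℕ → ℤ}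
    (h : IsFSigma (tSubgroup UnitAddCircle u : Set UnitAddCircle)) :
    ∃ F : Set UnitAddCircle, IsClosed F ∧ F ⊆ tSubgroup UnitAddCircle u ∧
      ∃ x ∈ tSubgroup UnitAddCircle u, ∃ ε > 0, ∀ z ∈ tSubgroup UnitAddCircle u,
        ‖z‖ ≤ ε → (∀ n, ‖u n • z‖ ≤ ε) → x + z ∈ F := by
  obtain ⟨F, hF, hU⟩ := h
  -- `S` is a copy of `t_u`: continuity at `∞` encodes `u n • x → 0`, and the sup metric encodes
  -- uniform smallness of all multiples. Being closed in a complete space, it is a Baire space.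
  let S : Set (UnitAddCircle × C(OnePoint ℕ, UnitAddCircle)) :=
    {p | p.2 OnePoint.infty = 0} ∩ ⋂ n : ℕ, {p | p.2 (n : OnePoint ℕ) = u n • p.1}
  have hS : IsClosed S := by
    refine IsClosed.inter (isClosed_eq (by fun_prop) (by fun_prop))
      (isClosed_iInter fun n => isClosed_eq (by fun_prop) (by fun_prop))
  have hmem : ∀ p ∈ S, p.1 ∈ tSubgroup UnitAddCircle u := by
    rintro ⟨x, f⟩ ⟨h0, hn⟩
    rw [Set.mem_iInter] at hn
    have hf := (OnePoint.continuous_iff_from_nat f).1 f.continuous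
    rw [mem_tSubgroup]
    refine (hf.congr hn).trans (le_of_eq (congrArg 𝓝 h0))
  let emb : ∀ z ∈ tSubgroup UnitAddCircle u, S := fun z hz =>
    ⟨(z, OnePoint.continuousMapMkNat (fun n => u n • z) 0 hz), rfl,
      Set.mem_iInter.2 fun n => rfl⟩
  have : CompleteSpace S := hS.completeSpace_coe
  have : Nonempty S := ⟨emb 0 (zero_mem _)⟩
  obtain ⟨m, p, hp⟩ := nonempty_interior_of_iUnion_of_closed
    (f := fun m => {p : S | p.1.1 ∈ F m})
    (fun m => (hF m).preimage (by fun_prop)) (by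
      ext p
      have hp := hmem p.1 p.2
      rw [← SetLike.mem_coe, hU] at hp
      simpa using hp)
  obtain ⟨ε, hε, hball⟩ := Metric.isOpen_iff.1 isOpen_interior p hp
  have hx := hmem p.1 p.2
  refine ⟨F m, hF m, hU ▸ Set.subset_iUnion F m, p.1.1, hx, ε / 2, half_pos hε, ?_⟩
  intro z hz hz0 hzn
  suffices hmem' : emb (p.1.1 + z) (add_mem hx hz) ∈ Metric.ball p ε from
    interior_subset (s := {p : S | p.1.1 ∈ F m}) (hball hmem')
  rw [Metric.mem_ball, Subtype.dist_eq, Prod.dist_eq, max_lt_iff]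
  constructor
  · simp only [emb, dist_eq_norm, add_sub_cancel_left]
    linarith
  · rw [ContinuousMap.dist_lt_iff hε]
    intro k
    induction k using OnePoint.rec with
    | infty =>
      have h0 : p.1.2 OnePoint.infty = 0 := p.2.1
      rw [h0]
      change dist (0 : UnitAddCircle) 0 < ε
      simpa using hε
    | coe n =>
      have hn : p.1.2 (n : OnePoint ℕ) = u n • p.1.1 := Set.mem_iInter.1 p.2.2 n
      rw [hn]
      change dist (u n • (p.1.1 + z)) (u n • p.1.1) < ε
      rw [dist_eq_norm, smul_add, add_sub_cancel_left]
      linarith [hzn n]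

/-! ### a-sequences -/

namespace IsASequence

variable {u : ℕ → ℤ}

theorem ne_zero (hu : IsASequence u) (n : ℕ) : u n ≠ 0 := by
  intro h
  have h1 := hu.2 n
  rw [h, zero_dvd_iff] at h1
  have h2 := hu.1 n.lt_succ_self
  simp only [Nat.succ_eq_add_one] at h2
  omega

/-- Divisibility keeps absolute values from decreasing, while negative terms that increase must
shrink. Only `u 0` can be negative, so later estimates use indices `n + 1`. -/
theorem pos (hu : IsASequence u) (n : ℕ) : 0 < u (n + 1) := by
  by_contra! hneg
  have h1 : u n < u (n + 1) := hu.1 n.lt_succ_self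
  have h2 : 0 < -u (n + 1) := by
    have := hu.ne_zero (n + 1)
    omega
  have h3 := Int.le_of_dvd h2 ((neg_dvd.2 (hu.2 n)).trans (dvd_neg.2 dvd_rfl))
  omega

theorem exists_ratio (hu : IsASequence u) :
    ∃ q : ℕ → ℤ, (∀ n, u (n + 1) = q n * u n) ∧ (∀ n, 2 ≤ q (n + 1)) ∧
      ∀ n, ratio u (n + 1) = q n := by
  choose q hq using hu.2
  refine ⟨q, fun n => by rw [hq, mul_comm], fun n => ?_, fun n => ?_⟩
  · have h1 : u (n + 1) < u (n + 1 + 1) := hu.1 (n + 1).lt_succ_self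
    rw [hq (n + 1)] at h1
    have := hu.pos n
    nlinarith
  · have h0 : (u n : ℚ) ≠ 0 := by exact_mod_cast hu.ne_zero n
    rw [ratio, hq n]
    push_cast
    field_simp

theorem two_mul_le (hu : IsASequence u) (n : ℕ) : 2 * u (n + 1) ≤ u (n + 2) := by
  obtain ⟨q, hq, hq2, -⟩ := hu.exists_ratio
  rw [show n + 2 = n + 1 + 1 from rfl, hq (n + 1)]
  exact mul_le_mul_of_nonneg_right (hq2 n) (hu.pos n).le

/-- With bounded ratios, multiples `u_n x` which stay close to `0` are eventually `0`. -/
theorem zsmul_eq_zero_of_norm_le (hu : IsASequence u) {C : ℝ}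
    (hC : ∀ n, |(ratio u n : ℝ)| ≤ C) {r : ℝ} (hr : C * r ≤ 1 / 2) {x : UnitAddCircle} {N : ℕ}
    (hx : ∀ n, N ≤ n → ‖u n • x‖ ≤ r) : u (N + 1) • x = 0 := by
  obtain ⟨q, hq, hq2, hqr⟩ := hu.exists_ratio
  -- The start is `N + 1` because `q 0` may be `-1`, which would not double the norm.
  have hstep : ∀ k, 2 ^ k * ‖u (N + 1) • x‖ ≤ ‖u (N + 1 + k) • x‖ := by
    intro k
    induction k with
    | zero => simp
    | succ k ih =>
      set n := N + 1 + k with hn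
      have hqn : (2 : ℝ) ≤ |(q n : ℝ)| := by
        have h2 : (2 : ℤ) ≤ q n := by
          rw [hn, show N + 1 + k = N + k + 1 by ring]
          exact hq2 _
        exact (by exact_mod_cast h2 : (2 : ℝ) ≤ q n).trans (le_abs_self _)
      have hqC : |(q n : ℝ)| ≤ C := by simpa [hqr] using hC (n + 1)
      have hle := hx n (by omega)
      have hnorm : ‖u (n + 1) • x‖ = |(q n : ℝ)| * ‖u n • x‖ := by
        rw [hq, mul_smul]
        exact norm_zsmul_circle
          ((mul_le_mul hqC hle (norm_nonneg _) ((abs_nonneg _).trans hqC)).trans hr)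
      rw [← add_assoc, ← hn, hnorm, pow_succ']
      calc 2 * 2 ^ k * ‖u (N + 1) • x‖ = 2 * (2 ^ k * ‖u (N + 1) • x‖) := by ring
        _ ≤ |(q n : ℝ)| * ‖u n • x‖ := by gcongr
  by_contra hne
  have hpos : 0 < ‖u (N + 1) • x‖ := norm_pos_iff.2 hne
  obtain ⟨k, hk⟩ := pow_unbounded_of_one_lt ((1 / 2) / ‖u (N + 1) • x‖) (one_lt_two (α := ℝ))
  rw [div_lt_iff₀ hpos] at hk
  exact absurd (hk.trans_le (hstep k)) (not_lt.2 (norm_circle_le_half _))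

theorem mem_tSubgroup_of_zsmul_eq_zero (hu : IsASequence u) {x : UnitAddCircle} {N : ℕ}
    (hx : u N • x = 0) : x ∈ tSubgroup UnitAddCircle u := by
  refine tendsto_const_nhds.congr' ?_
  filter_upwards [eventually_ge_atTop N] with n hn
  obtain ⟨c, hc⟩ := Nat.rel_of_forall_rel_succ_of_le (· ∣ ·) hu.2 hn
  rw [hc, mul_comm, mul_smul, hx, smul_zero]

theorem tSubgroup_le_ratCircle (hu : IsASequence u) {C : ℝ}
    (hC : ∀ n, |(ratio u n : ℝ)| ≤ C) : tSubgroup UnitAddCircle u ≤ ratCircle := by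
  intro x hx
  have hC0 : 0 ≤ C := (abs_nonneg _).trans (hC 0)
  have hr : (0 : ℝ) < 1 / (2 * (C + 1)) := by positivity
  have hev := (tendsto_zero_iff_norm_tendsto_zero.1 (mem_tSubgroup.1 hx)).eventually
    (gt_mem_nhds hr)
  obtain ⟨N, hN⟩ := eventually_atTop.1 hev
  refine mem_ratCircle_of_zsmul_eq_zero (hu.ne_zero (N + 1))
    (hu.zsmul_eq_zero_of_norm_le hC (r := 1 / (2 * (C + 1))) ?_ fun n hn => (hN n hn).le)
  rw [mul_one_div, div_le_div_iff₀ (by positivity) two_pos]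
  linarith

/-- With bounded ratios, `t_u` contains a uniform neighbourhood of `0`. -/
theorem exists_forall_norm_le_mem_tSubgroup (hu : IsASequence u) {C : ℝ}
    (hC : ∀ n, |(ratio u n : ℝ)| ≤ C) : ∃ r > 0, ∀ x : UnitAddCircle,
      (∀ n, ‖u n • x‖ ≤ r) → x ∈ tSubgroup UnitAddCircle u := by
  have hC0 : 0 ≤ C := (abs_nonneg _).trans (hC 0)
  refine ⟨1 / (2 * (C + 1)), by positivity, fun x hx => ?_⟩
  refine hu.mem_tSubgroup_of_zsmul_eq_zero
    (hu.zsmul_eq_zero_of_norm_le hC (N := 0) ?_ fun n _ => hx n)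
  rw [mul_one_div, div_le_div_iff₀ (by positivity) two_pos]
  linarith

/-- If the ratios are unbounded, they are frequently large. -/
theorem exists_le_ratio (hu : IsASequence u) (h : ¬∃ C : ℚ, ∀ n, |ratio u n| ≤ C) (B : ℝ)
    (N : ℕ) : ∃ n, N ≤ n ∧ B ≤ (u (n + 2) : ℝ) / u (n + 1) := by
  by_contra! hB
  obtain ⟨b, hb⟩ := exists_rat_gt B
  refine h ⟨|b| + ∑ i ∈ Finset.range (N + 2), |ratio u i|, fun n => ?_⟩
  rcases lt_or_ge n (N + 2) with hn | hn
  · have := Finset.single_le_sum (f := fun i => |ratio u i|) (fun i _ => abs_nonneg _)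
      (Finset.mem_range.2 hn)
    have := abs_nonneg b
    linarith
  · obtain ⟨k, rfl⟩ := Nat.exists_eq_add_of_le hn
    have hk := hB (N + k) (by omega)
    have hlt : ratio u (N + 2 + k) < b := by
      rw [show N + 2 + k = N + k + 1 + 1 by ring, ratio]
      have := hk.trans hb
      exact_mod_cast this
    have h0 : 0 ≤ ratio u (N + 2 + k) := by
      rw [show N + 2 + k = N + k + 1 + 1 by ring, ratio]
      have h1 := (hu.pos (N + k)).le
      have h2 := (hu.pos (N + k + 1)).le
      exact div_nonneg (by exact_mod_cast h2) (by exact_mod_cast h1)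
    have hs : 0 ≤ ∑ i ∈ Finset.range (N + 2), |ratio u i| :=
      Finset.sum_nonneg fun i _ => abs_nonneg _
    rw [abs_of_nonneg h0]
    linarith [le_abs_self b]

end IsASequence

/-! ### An element outside `t_u` close to `t_u` -/

/-- The partial sums of the series `∑ ⌊ε u_{n+2} / u_{n+1}⌋ / u_{n+2}`. -/
noncomputable def floorSum (u : ℕ → ℤ) (ε : ℝ) (k : ℕ) : ℝ :=
  ∑ n ∈ Finset.range k, (⌊ε * ((u (n + 2) : ℝ) / u (n + 1))⌋ : ℝ) / u (n + 2)

namespace IsASequence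

variable {u : ℕ → ℤ} {ε : ℝ}

theorem cast_pos (hu : IsASequence u) (n : ℕ) : (0 : ℝ) < u (n + 1) := by
  exact_mod_cast hu.pos n

theorem floorSum_mono (hu : IsASequence u) (hε : 0 < ε) : Monotone (floorSum u ε) := by
  refine monotone_nat_of_le_succ fun k => ?_
  rw [floorSum, floorSum, Finset.sum_range_succ, le_add_iff_nonneg_right]
  have h1 := hu.cast_pos k
  have h2 := hu.cast_pos (k + 1)
  have h3 : 0 ≤ ⌊ε * ((u (k + 2) : ℝ) / u (k + 1))⌋ := Int.floor_nonneg.2 (by positivity)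
  have h4 : (0 : ℝ) ≤ ⌊ε * ((u (k + 2) : ℝ) / u (k + 1))⌋ := by exact_mod_cast h3
  positivity

/-- The term added at `k` is at most `ε / u (k + 1)`, and `2 * u (k + 1) ≤ u (k + 2)` pays for it.
This bounds every tail without summing a geometric series. -/
theorem floorSum_add_anti (hu : IsASequence u) (hε : 0 < ε) :
    Antitone fun k => floorSum u ε k + 2 * ε / u (k + 1) := by
  refine antitone_nat_of_succ_le fun k => ?_
  simp only [floorSum]
  rw [Finset.sum_range_succ]
  have h1 := hu.cast_pos k
  have h2 : (0 : ℝ) < u (k + 2) := hu.cast_pos (k + 1)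
  have h3 : (2 : ℝ) * u (k + 1) ≤ u (k + 2) := by exact_mod_cast hu.two_mul_le k
  have h4 : (⌊ε * ((u (k + 2) : ℝ) / u (k + 1))⌋ : ℝ) / u (k + 2) ≤ ε / u (k + 1) := by
    rw [div_le_iff₀ h2]
    exact (Int.floor_le _).trans_eq (by ring)
  have h5 : 2 * ε / u (k + 2) ≤ ε / u (k + 1) := by
    rw [div_le_div_iff₀ h2 h1]
    nlinarith
  have h6 : 2 * ε / (u (k + 1) : ℝ) = ε / u (k + 1) + ε / u (k + 1) := by ring
  rw [show k + 1 + 1 = k + 2 from rfl, h6]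
  linarith

theorem floorSum_le (hu : IsASequence u) (hε : 0 < ε) {k l : ℕ} (h : k ≤ l) :
    floorSum u ε l ≤ floorSum u ε k + 2 * ε / u (k + 1) := by
  have h1 := hu.floorSum_add_anti hε h
  have h2 : 0 < 2 * ε / u (l + 1) := div_pos (by linarith) (hu.cast_pos l)
  simp only at h1
  linarith

/-- The denominators of the first `l` terms run up to `u (l + 1)`, and all divide `u (k + 1)`. -/
theorem zsmul_floorSum (hu : IsASequence u) {k l : ℕ} (h : l ≤ k) :
    u (k + 1) • ((floorSum u ε l : ℝ) : UnitAddCircle) = 0 := by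
  suffices H : ∃ m : ℤ, (u (k + 1) : ℝ) * floorSum u ε l = m by
    obtain ⟨m, hm⟩ := H
    rw [zsmul_coe_circle, hm, coe_intCast_circle]
  induction l with
  | zero => exact ⟨0, by simp [floorSum]⟩
  | succ l ih =>
    obtain ⟨m, hm⟩ := ih (by omega)
    obtain ⟨c, hc⟩ := Nat.rel_of_forall_rel_succ_of_le (· ∣ ·) hu.2 (by omega : l + 2 ≤ k + 1)
    refine ⟨m + ⌊ε * ((u (l + 2) : ℝ) / u (l + 1))⌋ * c, ?_⟩
    have h0 : (u (l + 2) : ℝ) ≠ 0 := (hu.cast_pos (l + 1)).ne'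
    rw [floorSum, Finset.sum_range_succ, mul_add, ← floorSum, hm, hc]
    push_cast
    field_simp

theorem norm_floorSum_le (hu : IsASequence u) (hε : 0 < ε) (l : ℕ) :
    ‖((floorSum u ε l : ℝ) : UnitAddCircle)‖ ≤ 2 * ε / u 1 := by
  refine (norm_coe_circle_le _).trans ?_
  have h0 : 0 ≤ floorSum u ε l := by
    simpa [floorSum] using hu.floorSum_mono hε (Nat.zero_le l)
  rw [abs_of_nonneg h0]
  simpa [floorSum] using hu.floorSum_le hε (Nat.zero_le l)

theorem norm_zsmul_floorSum_le (hu : IsASequence u) (hε : 0 < ε) (n l : ℕ) :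
    ‖u n • ((floorSum u ε l : ℝ) : UnitAddCircle)‖ ≤ 2 * ε := by
  cases n with
  -- The possibly negative `u 0` is handled through `|u 0| ≤ u 1`.
  | zero =>
    refine (norm_zsmul_le _ _).trans ?_
    have h1 : ‖u 0‖ ≤ u 1 := by
      have := Int.le_of_dvd (hu.pos 0) ((abs_dvd _ _).2 (hu.2 0))
      rw [Int.norm_eq_abs]
      exact_mod_cast this
    calc ‖u 0‖ * ‖((floorSum u ε l : ℝ) : UnitAddCircle)‖ ≤ u 1 * (2 * ε / u 1) :=
          mul_le_mul h1 (hu.norm_floorSum_le hε l) (norm_nonneg _) (hu.cast_pos 0).le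
      _ = 2 * ε := mul_div_cancel₀ _ (hu.cast_pos 0).ne'
  | succ k =>
    rcases le_total l k with h | h
    · rw [hu.zsmul_floorSum h, norm_zero]
      positivity
    · have hpos := hu.cast_pos k
      have h1 := hu.floorSum_mono hε h
      have h2 := hu.floorSum_le hε h
      have h3 : u (k + 1) • ((floorSum u ε l : ℝ) : UnitAddCircle) =
          ((u (k + 1) * (floorSum u ε l - floorSum u ε k) : ℝ) : UnitAddCircle) := by
        rw [← zsmul_coe_circle, AddCircle.coe_sub, smul_sub, hu.zsmul_floorSum le_rfl, sub_zero]
      rw [h3]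
      refine (norm_coe_circle_le _).trans ?_
      rw [abs_of_nonneg (mul_nonneg hpos.le (sub_nonneg.2 h1))]
      calc u (k + 1) * (floorSum u ε l - floorSum u ε k) ≤ u (k + 1) * (2 * ε / u (k + 1)) :=
            mul_le_mul_of_nonneg_left (by linarith) hpos.le
        _ = 2 * ε := mul_div_cancel₀ _ hpos.ne'

theorem exists_tendsto_floorSum (hu : IsASequence u) (hε : 0 < ε) :
    ∃ y, Tendsto (floorSum u ε) atTop (𝓝 y) ∧
      ∀ k, floorSum u ε k ≤ y ∧ y ≤ floorSum u ε k + 2 * ε / u (k + 1) := by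
  have hbdd : BddAbove (Set.range (floorSum u ε)) :=
    ⟨2 * ε / u 1, by
      rintro _ ⟨l, rfl⟩
      simpa [floorSum] using hu.floorSum_le hε (Nat.zero_le l)⟩
  have ht := tendsto_atTop_ciSup (hu.floorSum_mono hε) hbdd
  refine ⟨_, ht, fun k => ⟨le_ciSup hbdd k, le_of_tendsto ht ?_⟩⟩
  filter_upwards [eventually_ge_atTop k] with l hl using hu.floorSum_le hε hl

/-- If the ratios are unbounded, there is a point outside `t_u` that is a limit of points of `t_u`
on which all characters `u_n` are uniformly small. -/
theorem exists_tendsto_notMem_tSubgroup (hu : IsASequence u)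
    (h : ¬∃ C : ℚ, ∀ n, |ratio u n| ≤ C) {η : ℝ} (hη : 0 < η) :
    ∃ (z : ℕ → UnitAddCircle) (y : UnitAddCircle), Tendsto z atTop (𝓝 y) ∧
      (∀ k, z k ∈ tSubgroup UnitAddCircle u) ∧ (∀ k, ‖z k‖ ≤ η) ∧
      (∀ k n, ‖u n • z k‖ ≤ η) ∧ y ∉ tSubgroup UnitAddCircle u := by
  -- The bound `1 / 2` ensures that the tail scaled by `u (n + 1)` does not wrap around, so its norm
  -- is its absolute value.
  obtain ⟨ε, hε, hεη, hε4⟩ : ∃ ε : ℝ, 0 < ε ∧ 2 * ε ≤ η ∧ 2 * ε ≤ 1 / 2 :=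
    ⟨min η (1 / 2) / 2, by positivity, by linarith [min_le_left η (1 / 2)],
      by linarith [min_le_right η (1 / 2)]⟩
  obtain ⟨y, hy, hyk⟩ := hu.exists_tendsto_floorSum hε
  refine ⟨fun k => (floorSum u ε k : ℝ), y, ?_, fun k => ?_, fun k => ?_, fun k n => ?_, ?_⟩
  · exact ((AddCircle.continuous_mk' 1).tendsto y).comp hy
  · exact hu.mem_tSubgroup_of_zsmul_eq_zero (hu.zsmul_floorSum le_rfl)
  · refine (hu.norm_floorSum_le hε k).trans (le_trans (div_le_self (by positivity) ?_) hεη)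
    exact_mod_cast Int.add_one_le_iff.2 (hu.pos 0)
  · exact (hu.norm_zsmul_floorSum_le hε n k).trans hεη
  · intro hmem
    have hev := (tendsto_zero_iff_norm_tendsto_zero.1 (mem_tSubgroup.1 hmem)).eventually
      (gt_mem_nhds (half_pos hε))
    obtain ⟨N, hN⟩ := eventually_atTop.1 hev
    obtain ⟨n, hn, hq⟩ := hu.exists_le_ratio h (1 / ε) N
    have hpos := hu.cast_pos n
    have hpos' : (0 : ℝ) < u (n + 2) := hu.cast_pos (n + 1)
    have hlt := hN (n + 1) (by omega)
    have h3 : u (n + 1) • (y : UnitAddCircle) =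
        ((u (n + 1) * (y - floorSum u ε n) : ℝ) : UnitAddCircle) := by
      rw [← zsmul_coe_circle, AddCircle.coe_sub, smul_sub, hu.zsmul_floorSum le_rfl, sub_zero]
    have hupper : u (n + 1) * (y - floorSum u ε n) ≤ 2 * ε := by
      calc u (n + 1) * (y - floorSum u ε n) ≤ u (n + 1) * (2 * ε / u (n + 1)) :=
            mul_le_mul_of_nonneg_left (by linarith [(hyk n).2]) hpos.le
        _ = 2 * ε := mul_div_cancel₀ _ hpos.ne'
    have hlower : ε / 2 ≤ u (n + 1) * (y - floorSum u ε n) := by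
      set t : ℝ := ε * ((u (n + 2) : ℝ) / u (n + 1)) with ht
      have h1 : 1 ≤ t := by
        calc 1 = ε * (1 / ε) := by field_simp
          _ ≤ t := mul_le_mul_of_nonneg_left hq hε.le
      -- Since `t ≥ 1`, the floor loses at most half, so the single term at `n` already keeps `u (n
      -- + 1) • y` at distance `ε / 2` from `0`.
      have hfl : t / 2 ≤ ⌊t⌋ := by
        have ha := Int.lt_floor_add_one t
        have hb : (1 : ℤ) ≤ ⌊t⌋ := Int.le_floor.2 (by exact_mod_cast h1)
        have hb' : (1 : ℝ) ≤ ⌊t⌋ := by exact_mod_cast hb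
        linarith
      have hs : (⌊t⌋ : ℝ) / u (n + 2) ≤ y - floorSum u ε n := by
        have := (hyk (n + 1)).1
        rw [floorSum, Finset.sum_range_succ, ← floorSum] at this
        linarith
      calc ε / 2 = u (n + 1) * ((t / 2) / u (n + 2)) := by rw [ht]; field_simp
        _ ≤ u (n + 1) * ((⌊t⌋ : ℝ) / u (n + 2)) := by gcongr
        _ ≤ _ := mul_le_mul_of_nonneg_left hs hpos.le
    have habs : |u (n + 1) * (y - floorSum u ε n)| = u (n + 1) * (y - floorSum u ε n) :=
      abs_of_nonneg (by linarith)
    rw [h3, norm_coe_circle_of_le (by rw [habs]; linarith), habs] at hlt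
    linarith

end IsASequence

/-! ### Balls of `ϱ_u` -/

section Rho

variable {u : ℕ → ℤ} {δ : UnitAddCircle → UnitAddCircle → ℝ}

theorem dist_intChar (n : ℕ) (x y : UnitAddCircle) :
    dist (intChar u n x) (intChar u n y) = ‖u n • (x - y)‖ := by
  rw [dist_eq_norm, smul_sub]; rfl

theorem bddAbove_rho (x y : UnitAddCircle) :
    BddAbove (insert (δ x y) (Set.range fun n => dist (intChar u n x) (intChar u n y))) := by
  refine BddAbove.insert _ ⟨1 / 2, ?_⟩
  rintro _ ⟨n, rfl⟩
  simp only [dist_intChar]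
  exact norm_circle_le_half _

theorem norm_zsmul_sub_le_rho (n : ℕ) (x y : UnitAddCircle) :
    ‖u n • (x - y)‖ ≤ rho δ (intChar u) x y := by
  rw [← dist_intChar]
  exact le_csSup (bddAbove_rho x y) (Set.mem_insert_of_mem _ ⟨n, rfl⟩)

theorem rho_le {x y : UnitAddCircle} {r : ℝ} (h : δ x y ≤ r)
    (h' : ∀ n, ‖u n • (x - y)‖ ≤ r) : rho δ (intChar u) x y ≤ r := by
  refine csSup_le (Set.insert_nonempty _ _) ?_
  rintro _ (rfl | ⟨n, rfl⟩)
  · exact h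
  · simpa only [dist_intChar] using h' n

theorem IsCompatibleMetric.eventually_lt {X : Type*} [TopologicalSpace X] {δ : X → X → ℝ}
    (hδ : IsCompatibleMetric δ) (x : X) {ε : ℝ} (hε : 0 < ε) : ∀ᶠ y in 𝓝 x, δ y x < ε := by
  obtain ⟨m, hm, hd⟩ := hδ
  subst hm
  simp only [← hd]
  exact Metric.ball_mem_nhds x hε

/-- If the ratios are unbounded, no ball of `ϱ_u` around `0` lies in `t_u`. -/
theorem IsASequence.not_ballOf_subset_tSubgroup (hu : IsASequence u)
    (hδ : IsCompatibleMetric δ) (h : ¬∃ C : ℚ, ∀ n, |ratio u n| ≤ C) {ε : ℝ} (hε : 0 < ε) :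
    ¬ballOf (rho δ (intChar u)) 0 ε ⊆ tSubgroup UnitAddCircle u := by
  intro hsub
  -- Only the topology of `δ` is known, so its smallness at `y` is obtained from a small `‖y‖`.
  obtain ⟨η, hη, hball⟩ := Metric.eventually_nhds_iff.1 (hδ.eventually_lt 0 (half_pos hε))
  obtain ⟨z, y, hzy, -, hz0, hzn, hy⟩ := hu.exists_tendsto_notMem_tSubgroup h
    (η := min (η / 2) (ε / 2)) (lt_min (half_pos hη) (half_pos hε))
  refine hy (hsub (lt_of_le_of_lt (rho_le (r := ε / 2) ?_ fun n => ?_) (half_lt_self hε)))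
  · refine (hball ?_).le
    rw [dist_zero_right]
    have h1 : ‖y‖ ≤ min (η / 2) (ε / 2) := le_of_tendsto' hzy.norm hz0
    linarith [min_le_left (η / 2) (ε / 2)]
  · rw [sub_zero]
    exact (le_of_tendsto' (hzy.const_smul (u n)).norm fun k => hzn k n).trans (min_le_right _ _)

end Rho

end CharSub

open CharSub Filter Topology in
theorem theoremE (u : ℕ → ℤ) (hu : CharSub.IsASequence u)
    (δ : UnitAddCircle → UnitAddCircle → ℝ) (hδ : CharSub.IsCompatibleMetric δ) :
    List.TFAE [
      ∃ C : ℚ, ∀ n, |CharSub.ratio u n| ≤ C,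
      CharSub.tSubgroup UnitAddCircle u ≤ CharSub.ratCircle,
      (CharSub.tSubgroup UnitAddCircle u : Set UnitAddCircle).Countable,
      CharSub.IsFSigma (CharSub.tSubgroup UnitAddCircle u : Set UnitAddCircle),
      @IsOpen UnitAddCircle (CharSub.tauStar δ (CharSub.intChar u))
        (CharSub.tSubgroup UnitAddCircle u : Set UnitAddCircle),
      @IsOpen UnitAddCircle (CharSub.tau δ (CharSub.intChar u))
        (CharSub.tSubgroup UnitAddCircle u : Set UnitAddCircle)] := by
  have hcast : (∃ C : ℚ, ∀ n, |ratio u n| ≤ C) → ∃ C : ℝ, ∀ n, |(ratio u n : ℝ)| ≤ C := by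
    rintro ⟨C, hC⟩
    exact ⟨C, fun n => by exact_mod_cast hC n⟩
  tfae_have 1 → 2 := by
    intro h
    obtain ⟨C, hC⟩ := hcast h
    exact hu.tSubgroup_le_ratCircle hC
  tfae_have 2 → 3 := fun h => countable_ratCircle.mono h
  tfae_have 3 → 4 := isFSigma_of_countable
  tfae_have 4 → 1 := by
    intro h
    obtain ⟨F, hF, hFsub, x, hx, ε, hε, hball⟩ := exists_closed_of_isFSigma_tSubgroup h
    by_contra hq
    obtain ⟨z, y, hzy, hzt, hz0, hzn, hy⟩ := hu.exists_tendsto_notMem_tSubgroup hq hε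
    refine hy ((AddSubgroup.add_mem_cancel_left _ hx).1 (hFsub (?_ : x + y ∈ F)))
    exact hF.mem_of_tendsto (hzy.const_add x)
      (Eventually.of_forall fun k => hball _ (hzt k) (hz0 k) (hzn k))
  tfae_have 1 → 5 := by
    intro h x hx
    obtain ⟨C, hC⟩ := hcast h
    obtain ⟨r, hr, hsub⟩ := hu.exists_forall_norm_le_mem_tSubgroup hC
    obtain ⟨n, hn⟩ := exists_nat_one_div_lt hr
    refine ⟨n + 1, by omega, fun w hw => add_mem hx (hsub w fun k => ?_)⟩
    -- Each non-strict bound is a closed condition, so it passes from the ball to its closure.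
    have hcl : IsClosed {w : UnitAddCircle | ‖u k • w‖ ≤ r} :=
      isClosed_le (continuous_zsmul (u k)).norm continuous_const
    refine closure_minimal (fun w hw => ?_) hcl hw
    have h1 := norm_zsmul_sub_le_rho (u := u) (δ := δ) k w 0
    have h2 : rho δ (intChar u) w 0 < 1 / ((n + 1 : ℕ) : ℝ) := hw
    rw [sub_zero] at h1
    push_cast at h2
    exact (h1.trans_lt (h2.trans hn)).le
  tfae_have 5 → 1 := by
    intro h
    by_contra hq
    obtain ⟨n, hn, hsub⟩ := h 0 (zero_mem _)
    refine hu.not_ballOf_subset_tSubgroup hδ hq (ε := 1 / (n : ℝ)) (by positivity) fun w hw => ?_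
    simpa using hsub w (subset_closure hw)
  tfae_have 1 → 6 := by
    intro h x hx
    obtain ⟨C, hC⟩ := hcast h
    obtain ⟨r, hr, hsub⟩ := hu.exists_forall_norm_le_mem_tSubgroup hC
    refine ⟨r, hr, fun y hy => ?_⟩
    have hyx := hsub (y - x) fun n => (norm_zsmul_sub_le_rho n y x).trans (le_of_lt hy)
    simpa using add_mem hyx hx
  tfae_have 6 → 1 := by
    intro h
    by_contra hq
    obtain ⟨ε, hε, hsub⟩ := h 0 (zero_mem _)
    exact hu.not_ballOf_subset_tSubgroup hδ hq hε hsub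
  tfae_finish
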